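/- For an integer $q\ge 1$ and a real $\lambda\ge 0$, let $\chi^2_q(\lambda)$ be the noncentral chi-square distribution with $q$ degrees of freedom and noncentrality parameter $\lambda$, that is, the law of $\|x\|^2$ for a Gaussian vector $x\sim\mathcal N(m,I_q)$ in $\mathbb R^q$ with $\|m\|^2=\lambda$ (this law depends on $m$ only through $\lambda$), and let $\chi^2_q=\chi^2_q(0)$ be the central chi-square distribution. For $x\ge 0$ let $\mathcal Q_q(x)$ and $\mathcal Q_q(x;\lambda)$ be the right tail probabilities of $\chi^2_q$ and $\chi^2_q(\lambda)$, that is, the probabilities that a variable with that law is greater than $x$. The function $\mathcal Q_q$ is a bijection from $[0,\infty)$ onto $(0,1]$; let $\mathcal Q_q^{-1}$ be its inverse. For a false-alarm probability $P_F\in(0,1]$ define the threshold and the detection probability by $$\tau(q,P_F)=\mathcal Q_q^{-1}(P_F),\qquad P_D(q,\lambda,P_F)=\mathcal Q_q\big(\tau(q,P_F);\lambda\big).$$ Then for every fixed $P_F\in(0,1]$: 1. for every integer $q\ge 1$, the function $\lambda\mapsto P_D(q,\lambda,P_F)$ is nondecreasing on $[0,\infty)$, and it is strictly increasing there if $P_F<1$;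 2. for every $\lambda\ge 0$, the function $q\mapsto P_D(q,\lambda,P_F)$ is nonincreasing on $\{1,2,3,\dots\}$, and it is strictly decreasing there if $P_F<1$ and $\lambda>0$. -/

import Mathlib

open MeasureTheory ProbabilityTheory Set

namespace ChiSquareTest

/-- The law of `x₁² + ⋯ + x_q²`, where the `xᵢ` are independent Gaussian variables with
means `mᵢ` and variance one, that is, of `‖x‖²` for `x ∼ 𝒩(m, I_q)`. -/
noncomputable def sumSqLaw {q : ℕ} (m : Fin q → ℝ) : Measure ℝ :=
  (Measure.pi fun i => gaussianReal (m i) 1).map fun x => ∑ i, x i ^ 2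

/-- The central chi-square distribution with `q` degrees of freedom. -/
noncomputable def chiSq (q : ℕ) : Measure ℝ :=
  sumSqLaw (0 : Fin q → ℝ)

/-- The vector `(√lam, 0, …, 0)` of length `q`; its squared length is `lam`
if `1 ≤ q` and `0 ≤ lam`. -/
noncomputable def meanVec (q : ℕ) (lam : ℝ) (i : Fin q) : ℝ :=
  if (i : ℕ) = 0 then √lam else 0

/-- The noncentral chi-square distribution with `q` degrees of freedom and noncentrality
parameter `lam` (for `1 ≤ q`, `0 ≤ lam`). It is the law of `‖x‖²` for `x ∼ 𝒩(m, I_q)` with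
any mean vector `m` such that `‖m‖² = lam`, see `sumSqLaw_eq_noncentralChiSq`. -/
noncomputable def noncentralChiSq (q : ℕ) (lam : ℝ) : Measure ℝ :=
  sumSqLaw (meanVec q lam)

/-- Right tail probability of the chi-square distribution. -/
noncomputable def tail (q : ℕ) (x : ℝ) : ℝ :=
  (chiSq q).real (Ioi x)

/-- Right tail probability of the noncentral chi-square distribution. -/
noncomputable def noncentralTail (q : ℕ) (x lam : ℝ) : ℝ :=
  (noncentralChiSq q lam).real (Ioi x)

/-- The threshold for the false alarm probability `PF`: the inverse of the right tail function
`tail q : [0, ∞) → (0, 1]` (see `bijOn_tail`) at `PF`. -/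
noncomputable def threshold (q : ℕ) (PF : ℝ) : ℝ :=
  Function.invFunOn (tail q) (Ici 0) PF

/-- The detection probability. -/
noncomputable def detectionProb (q : ℕ) (lam PF : ℝ) : ℝ :=
  noncentralTail q (threshold q PF) lam

/-! ### The definitions are meaningful -/

theorem sumSqLaw_eq_map_stdGaussian {q : ℕ} (m : Fin q → ℝ) :
    sumSqLaw m = (stdGaussian (EuclideanSpace ℝ (Fin q))).map
      fun z => ‖z + WithLp.toLp 2 m‖ ^ 2 := by
  have h1 : (Measure.pi fun i => gaussianReal (m i) 1)
      = (Measure.pi fun _ : Fin q => gaussianReal 0 1).map (fun x i => x i + m i) := by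
    have hsf : ∀ i, SigmaFinite ((gaussianReal 0 1).map fun y => y + m i) := fun i => by
      rw [gaussianReal_map_add_const]; infer_instance
    have h := Measure.pi_map_pi (μ := fun _ : Fin q => gaussianReal 0 1)
      (f := fun i (y : ℝ) => y + m i) (hμ := hsf) (fun i => by fun_prop)
    rw [h]
    simp [gaussianReal_map_add_const]
  rw [sumSqLaw, h1, ← map_pi_eq_stdGaussian, Measure.map_map (by fun_prop) (by fun_prop),
    Measure.map_map (by fun_prop) (by fun_prop)]
  congr 1
  ext x
  simp [EuclideanSpace.norm_sq_eq]

/-- The law of `‖x‖²`, `x ∼ 𝒩(m, I_q)`, depends on `m` only through `‖m‖²`. -/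
theorem sumSqLaw_congr {q : ℕ} (m m' : Fin q → ℝ) (h : ∑ i, m i ^ 2 = ∑ i, m' i ^ 2) :
    sumSqLaw m = sumSqLaw m' := by
  have hn : ‖(WithLp.toLp 2 m : EuclideanSpace ℝ (Fin q))‖
      = ‖(WithLp.toLp 2 m' : EuclideanSpace ℝ (Fin q))‖ := by
    simp [EuclideanSpace.norm_eq, h]
  have hr := Submodule.reflection_sub hn
  set R := (Submodule.span ℝ {(WithLp.toLp 2 m : EuclideanSpace ℝ (Fin q))
    - WithLp.toLp 2 m'})ᗮ.reflection
  rw [sumSqLaw_eq_map_stdGaussian, sumSqLaw_eq_map_stdGaussian, ← stdGaussian_map R,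
    Measure.map_map (by fun_prop) R.continuous.measurable, stdGaussian_map R]
  congr 1
  ext z
  simp only [Function.comp]
  rw [← LinearIsometryEquiv.norm_map R (R z + _), map_add, hr, Submodule.reflection_reflection]

theorem sumSqLaw_eq_noncentralChiSq {q : ℕ} (hq : 1 ≤ q) (m : Fin q → ℝ) :
    sumSqLaw m = noncentralChiSq q (∑ i, m i ^ 2) := by
  apply sumSqLaw_congr
  obtain ⟨n, rfl⟩ : ∃ n, q = n + 1 := ⟨q - 1, by omega⟩
  rw [Fin.sum_univ_succ (fun i => meanVec (n + 1) _ i ^ 2)]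
  simp [meanVec, Real.sq_sqrt (Finset.sum_nonneg fun i _ => sq_nonneg (m i))]

theorem noncentralChiSq_zero (q : ℕ) : noncentralChiSq q 0 = chiSq q := by
  have : meanVec q 0 = 0 := by ext i; simp [meanVec]
  rw [noncentralChiSq, chiSq, this]

instance isProbabilityMeasure_sumSqLaw {q : ℕ} (m : Fin q → ℝ) :
    IsProbabilityMeasure (sumSqLaw m) :=
  Measure.isProbabilityMeasure_map (Measurable.aemeasurable (by fun_prop))

theorem sumSqLaw_singleton {n : ℕ} (m : Fin (n + 1) → ℝ) (c : ℝ) : sumSqLaw m {c} = 0 := by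
  have hmp := measurePreserving_piFinSuccAbove (fun i => gaussianReal (m i) 1) 0
  have hm : Measurable fun p : ℝ × (Fin n → ℝ) => p.1 ^ 2 + ∑ i, p.2 i ^ 2 := by fun_prop
  have hs := hm (measurableSet_singleton c)
  have hnull : ((gaussianReal (m 0) 1).prod
      (Measure.pi fun i : Fin n => gaussianReal (m ((0 : Fin (n + 1)).succAbove i)) 1))
      ((fun p : ℝ × (Fin n → ℝ) => p.1 ^ 2 + ∑ i, p.2 i ^ 2) ⁻¹' {c}) = 0 := by
    rw [Measure.prod_apply_symm hs, lintegral_eq_zero_iff (measurable_measure_prodMk_right hs)]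
    refine Filter.Eventually.of_forall fun y => ?_
    have := nullSingletonClass_gaussianReal (μ := m 0) (v := 1) one_ne_zero
    refine Set.Finite.measure_zero (Set.Finite.subset
      (Set.toFinite {√(c - ∑ i, y i ^ 2), -√(c - ∑ i, y i ^ 2)}) ?_) _
    intro x hx
    have hx' : x ^ 2 + ∑ i, y i ^ 2 = c := hx
    have hxx : x ^ 2 = c - ∑ i, y i ^ 2 := by linarith
    have h2 : |x| = √(c - ∑ i, y i ^ 2) := by rw [← hxx, Real.sqrt_sq_eq_abs]
    rcases abs_choice x with h | h
    · left; rw [← h2, h]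
    · right; rw [mem_singleton_iff, ← h2, h, neg_neg]
  rw [← hmp.measure_preimage hs.nullMeasurableSet] at hnull
  rw [sumSqLaw, Measure.map_apply (by fun_prop) (measurableSet_singleton c), ← hnull]
  congr 1
  ext x
  simp [Fin.sum_univ_succ, MeasurableEquiv.piFinSuccAbove, Fin.tail]

theorem sumSqLaw_Ioo_pos {n : ℕ} (m : Fin (n + 1) → ℝ) {a b : ℝ} (ha : 0 ≤ a) (hab : a < b) :
    0 < sumSqLaw m (Ioo a b) := by
  rw [sumSqLaw, Measure.map_apply (by fun_prop) measurableSet_Ioo]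
  have : ∀ i, (gaussianReal (m i) 1).IsOpenPosMeasure := fun i =>
    (gaussianReal_absolutelyContinuous' (m i) one_ne_zero).isOpenPosMeasure
  refine IsOpen.measure_pos _ (isOpen_Ioo.preimage (by fun_prop)) ⟨Fin.cons √((a + b) / 2) 0, ?_⟩
  have : √((a + b) / 2) ^ 2 = (a + b) / 2 := Real.sq_sqrt (by linarith)
  simp only [mem_preimage, Fin.sum_univ_succ, Fin.cons_zero, Fin.cons_succ, this]
  constructor <;> simp <;> linarith

theorem sumSqLaw_Iio_zero {q : ℕ} (m : Fin q → ℝ) : sumSqLaw m (Iio 0) = 0 := by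
  rw [sumSqLaw, Measure.map_apply (by fun_prop) measurableSet_Iio]
  have : (fun x : Fin q → ℝ => ∑ i, x i ^ 2) ⁻¹' Iio 0 = ∅ := by
    ext x
    simp [Finset.sum_nonneg fun i _ => sq_nonneg (x i)]
  rw [this, measure_empty]

/-- The right tail function of the chi-square distribution is a bijection from `[0, ∞)` onto
`(0, 1]`, so that its inverse, and hence the threshold, is defined on `(0, 1]`. -/
theorem bijOn_tail {q : ℕ} (hq : 1 ≤ q) : BijOn (tail q) (Ici 0) (Ioc 0 1) := by
  obtain ⟨n, rfl⟩ : ∃ n, q = n + 1 := ⟨q - 1, by omega⟩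
  have hprob : IsProbabilityMeasure (chiSq (n + 1)) := isProbabilityMeasure_sumSqLaw _
  have hna : NullSingletonClass (chiSq (n + 1)) := ⟨sumSqLaw_singleton _⟩
  have htail : ∀ x, tail (n + 1) x = 1 - cdf (chiSq (n + 1)) x := fun x => by
    rw [cdf_eq_real, tail, ← compl_Iic, probReal_compl_eq_one_sub measurableSet_Iic]
  have hcont : Continuous (cdf (chiSq (n + 1))) := by
    rw [continuous_iff_continuousAt]
    intro x
    rw [(monotone_cdf _).continuousAt_iff_leftLim_eq_rightLim,
      StieltjesFunction.rightLim_eq]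
    have h := (cdf (chiSq (n + 1))).measure_singleton x
    rw [measure_cdf, hna.measure_singleton] at h
    have h' := ENNReal.ofReal_eq_zero.1 h.symm
    exact le_antisymm ((monotone_cdf _).leftLim_le le_rfl) (by linarith)
  have hstrict : StrictAntiOn (tail (n + 1)) (Ici 0) := by
    intro x hx y _ hxy
    have h1 : tail (n + 1) x = (chiSq (n + 1)).real (Ioc x y) + tail (n + 1) y := by
      rw [tail, tail, ← Ioc_union_Ioi_eq_Ioi hxy.le, measureReal_union
        (Ioc_disjoint_Ioi le_rfl) measurableSet_Ioi]
    have h2 : 0 < (chiSq (n + 1)).real (Ioc x y) :=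
      ENNReal.toReal_pos ((sumSqLaw_Ioo_pos 0 hx hxy).trans_le
        (measure_mono Ioo_subset_Ioc_self)).ne' (measure_ne_top _ _)
    linarith
  have h0 : tail (n + 1) 0 = 1 := by
    have h : chiSq (n + 1) (Iic 0) = 0 := by
      rw [← Iio_union_right]
      exact measure_union_null (sumSqLaw_Iio_zero _) (hna.measure_singleton 0)
    rw [htail, cdf_eq_real, measureReal_def, h]
    simp
  refine ⟨?_, hstrict.injOn, ?_⟩
  · intro x hx
    have hx0 : (0 : ℝ) ≤ x := hx
    refine ⟨?_, measureReal_le_one⟩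
    have h1 := hstrict hx (show x + 1 ∈ Ici (0 : ℝ) from by simp; linarith) (by linarith)
    exact lt_of_le_of_lt measureReal_nonneg h1
  · intro p hp
    obtain ⟨y, hy⟩ := ((tendsto_cdf_atTop (chiSq (n + 1))).eventually
      (lt_mem_nhds (show 1 - p < 1 by linarith [hp.1]))).and
        (Filter.eventually_ge_atTop (0 : ℝ)) |>.exists
    have hc : ContinuousOn (tail (n + 1)) (Icc 0 y) := by
      rw [show tail (n + 1) = fun x => 1 - cdf (chiSq (n + 1)) x from funext htail]
      exact (continuous_const.sub hcont).continuousOn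
    obtain ⟨x, hx, hxp⟩ := intermediate_value_Icc' hy.2 hc
      (show p ∈ Icc (tail (n + 1) y) (tail (n + 1) 0) from
        ⟨by rw [htail]; linarith [hy.1], by rw [h0]; exact hp.2⟩)
    exact ⟨x, hx.1, hxp⟩

end ChiSquareTest

namespace ChiSquareTest

/-! Both monotonicities come from conditioning on all coordinates but one.

In `lam`: isolate the coordinate carrying the mean `√lam`. Given the sum `s` of the other squares,
the tail event is `t - s < x ^ 2`, and its Gaussian probability grows with the mean, strictly when
`s < t` (`strictMonoOn_gaussianReal_sq_tail`). Since `t` does not depend on `lam`, integrating over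
`s` suffices.

In `q`: isolate instead a coordinate of mean zero. The test with `q + 1` degrees of freedom becomes
a randomised test on the `q`-dimensional statistic `s`, of the same size `PF`. The noncentral law
has an increasing density with respect to the central one (`noncentralChiSq_eq_withDensity`,
`strictMonoOn_chiSqDensity`), so by Neyman–Pearson (`integral_mul_lt_setIntegral_Ioi`) the threshold
test with `q` degrees of freedom is strictly more powerful. -/

theorem sumSqLaw_eq_map_prod {n : ℕ} (m : Fin (n + 1) → ℝ) (p : Fin (n + 1)) :
    sumSqLaw m = ((gaussianReal (m p) 1).prod (sumSqLaw fun i => m (p.succAbove i))).map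
      fun z => z.1 ^ 2 + z.2 := by
  have hmp := (measurePreserving_piFinSuccAbove (fun i => gaussianReal (m i) 1) p).map_eq
  have hid : (gaussianReal (m p) 1).prod (sumSqLaw fun i => m (p.succAbove i))
      = ((gaussianReal (m p) 1).prod (Measure.pi fun i : Fin n =>
        gaussianReal (m (p.succAbove i)) 1)).map (Prod.map id fun x => ∑ i, x i ^ 2) := by
    rw [← Measure.map_prod_map _ _ measurable_id (by fun_prop), Measure.map_id, sumSqLaw]
  rw [hid, Measure.map_map (by fun_prop) (by fun_prop), ← hmp,
    Measure.map_map (by fun_prop) (MeasurableEquiv.measurable _), sumSqLaw]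
  congr 1
  ext x
  exact Fin.sum_univ_succAbove (fun i => x i ^ 2) p

/-- Disintegration of the tail probability along one coordinate. -/
theorem real_sumSqLaw_Ioi {n : ℕ} (m : Fin (n + 1) → ℝ) (p : Fin (n + 1)) (t : ℝ) :
    (sumSqLaw m).real (Ioi t) = ∫ s, (gaussianReal (m p) 1).real {x | t - s < x ^ 2}
      ∂sumSqLaw fun i => m (p.succAbove i) := by
  have hms : MeasurableSet ((fun z : ℝ × ℝ => z.1 ^ 2 + z.2) ⁻¹' Ioi t) :=
    measurableSet_Ioi.preimage (by fun_prop)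
  rw [sumSqLaw_eq_map_prod m p, measureReal_def, Measure.map_apply (by fun_prop) measurableSet_Ioi,
    Measure.prod_apply_symm hms, ← integral_toReal]
  · refine integral_congr_ae (Filter.Eventually.of_forall fun s => ?_)
    simp only [measureReal_def]
    congr 2
    ext x
    simp [sub_lt_iff_lt_add]
  · exact (measurable_measure_prodMk_right hms).aemeasurable
  · exact Filter.Eventually.of_forall fun s => measure_lt_top _ _

theorem measurable_gaussianReal_sq_tail (μ t : ℝ) :
    Measurable fun s => (gaussianReal μ 1).real {x | t - s < x ^ 2} := by
  have hms : MeasurableSet {z : ℝ × ℝ | t - z.2 < z.1 ^ 2} :=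
    measurableSet_lt (by fun_prop) (by fun_prop)
  exact (measurable_measure_prodMk_right (μ := gaussianReal μ 1) hms).ennreal_toReal

theorem integrable_gaussianReal_sq_tail (μ t : ℝ) (ν : Measure ℝ) [IsFiniteMeasure ν] :
    Integrable (fun s => (gaussianReal μ 1).real {x | t - s < x ^ 2}) ν :=
  .of_bound (measurable_gaussianReal_sq_tail μ t).aestronglyMeasurable 1
    (.of_forall fun s => by
      rw [Real.norm_of_nonneg measureReal_nonneg]; exact measureReal_le_one)

/-! ### The tail of a squared Gaussian as a function of its mean -/

theorem gaussianReal_sq_tail_pos (μ s : ℝ) : 0 < (gaussianReal μ 1).real {x | s < x ^ 2} := by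
  have : (gaussianReal μ 1).IsOpenPosMeasure :=
    (gaussianReal_absolutelyContinuous' μ one_ne_zero).isOpenPosMeasure
  refine ENNReal.toReal_pos (IsOpen.measure_pos _ (isOpen_lt (by fun_prop) (by fun_prop))
    ⟨|s| + 1, ?_⟩).ne' (measure_ne_top _ _)
  simp only [mem_ofPred_eq]
  nlinarith [le_abs_self s, abs_nonneg s]

theorem real_gaussianReal_Icc (μ : ℝ) {c : ℝ} (hc : 0 ≤ c) :
    (gaussianReal μ 1).real (Icc (-c) c) = ∫ x in (-c - μ)..(c - μ), gaussianPDFReal 0 1 x := by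
  rw [measureReal_def, gaussianReal_apply_eq_integral _ one_ne_zero, ENNReal.toReal_ofReal
    (integral_nonneg fun x => gaussianPDFReal_nonneg _ _ _), integral_Icc_eq_integral_Ioc,
    ← intervalIntegral.integral_of_le (by linarith),
    ← intervalIntegral.integral_comp_sub_right (fun x => gaussianPDFReal 0 1 x)]
  simp [gaussianPDFReal]

/-- The derivative in `μ` is the standard density at `-c - μ` minus that at `c - μ`; it is negative
for `μ > 0` because `|c - μ| < c + μ`. -/
theorem strictAntiOn_gaussianReal_Icc {c : ℝ} (hc : 0 < c) :
    StrictAntiOn (fun μ : ℝ => (gaussianReal μ 1).real (Icc (-c) c)) (Ici 0) := by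
  have hcont : Continuous (gaussianPDFReal 0 1) := by
    unfold gaussianPDFReal; fun_prop
  have hderiv : ∀ μ : ℝ, HasDerivAt (fun μ : ℝ => (gaussianReal μ 1).real (Icc (-c) c))
      (gaussianPDFReal 0 1 (-c - μ) - gaussianPDFReal 0 1 (c - μ)) μ := by
    intro μ
    have hΦ : ∀ y, HasDerivAt (fun y => ∫ x in (0 : ℝ)..y, gaussianPDFReal 0 1 x)
        (gaussianPDFReal 0 1 y) y := fun y => (hcont.integral_hasStrictDerivAt 0 y).hasDerivAt
    have hsub : ∀ a : ℝ, HasDerivAt (fun μ : ℝ => a - μ) (-1) μ := fun a =>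
      (hasDerivAt_id μ).const_sub a
    have h := ((hΦ (c - μ)).comp μ (hsub c)).sub ((hΦ (-c - μ)).comp μ (hsub (-c)))
    refine (h.congr_deriv (by ring)).congr_of_eventuallyEq (.of_forall fun ν => ?_)
    simp only
    rw [real_gaussianReal_Icc ν hc.le]
    exact (intervalIntegral.integral_interval_sub_left (hcont.intervalIntegrable _ _)
      (hcont.intervalIntegrable _ _)).symm
  refine strictAntiOn_of_deriv_neg (convex_Ici 0)
    (fun μ _ => (hderiv μ).continuousAt.continuousWithinAt) fun μ hμ => ?_
  rw [interior_Ici, mem_Ioi] at hμ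
  rw [(hderiv μ).deriv, sub_neg, gaussianPDFReal, gaussianPDFReal]
  refine mul_lt_mul_of_pos_left (Real.exp_lt_exp.2 ?_) (by positivity)
  simp only [NNReal.coe_one, sub_zero]
  nlinarith [mul_pos hc hμ]

theorem gaussianReal_sq_tail_eq (μ s : ℝ) :
    (gaussianReal μ 1).real {x | s < x ^ 2}
      = if s < 0 then 1 else 1 - (gaussianReal μ 1).real (Icc (-√s) √s) := by
  split_ifs with hs
  · rw [show {x : ℝ | s < x ^ 2} = univ from eq_univ_of_forall fun x => hs.trans_le (sq_nonneg x)]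
    simp
  · rw [← probReal_compl_eq_one_sub measurableSet_Icc]
    congr 1
    ext x
    rw [mem_ofPred_eq, mem_compl_iff, mem_Icc, ← abs_le, not_le, ← Real.sqrt_sq_eq_abs,
      Real.sqrt_lt_sqrt_iff (not_lt.1 hs)]

theorem strictMonoOn_gaussianReal_sq_tail {s : ℝ} (hs : 0 < s) :
    StrictMonoOn (fun μ : ℝ => (gaussianReal μ 1).real {x | s < x ^ 2}) (Ici 0) := by
  intro μ hμ ν hν h
  simp only [gaussianReal_sq_tail_eq, not_lt.2 hs.le, if_false]
  have := strictAntiOn_gaussianReal_Icc (Real.sqrt_pos.2 hs) hμ hν h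
  simp only at this
  linarith

theorem monotoneOn_gaussianReal_sq_tail (s : ℝ) :
    MonotoneOn (fun μ : ℝ => (gaussianReal μ 1).real {x | s < x ^ 2}) (Ici 0) := by
  -- For `s ≤ 0` the event is almost sure whatever the mean: it misses at most the null point `0`.
  rcases lt_trichotomy s 0 with hs | rfl | hs
  · simp only [gaussianReal_sq_tail_eq, hs, if_true]
    exact monotoneOn_const
  · have : ∀ μ : ℝ, NullSingletonClass (gaussianReal μ 1) := fun μ =>
      nullSingletonClass_gaussianReal one_ne_zero
    intro μ _ ν _ _
    have h0 : ∀ μ : ℝ, (gaussianReal μ 1).real {0} = 0 := fun μ => by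
      rw [measureReal_def, measure_singleton, ENNReal.toReal_zero]
    simp only [gaussianReal_sq_tail_eq, lt_irrefl, if_false, Real.sqrt_zero, neg_zero, Icc_self,
      h0, le_refl]
  · exact (strictMonoOn_gaussianReal_sq_tail hs).monotoneOn

/-- The case `n = 0`, needed for one degree of freedom, is the Dirac mass at `0`; this is why the
interval is `Iio t` and not `Ioo 0 t`. -/
theorem sumSqLaw_Iio_pos {n : ℕ} {t : ℝ} (ht : 0 < t) :
    0 < sumSqLaw (0 : Fin n → ℝ) (Iio t) := by
  rw [sumSqLaw, Measure.map_apply (by fun_prop) measurableSet_Iio]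
  have : ∀ i : Fin n, (gaussianReal ((0 : Fin n → ℝ) i) 1).IsOpenPosMeasure := fun i =>
    (gaussianReal_absolutelyContinuous' _ one_ne_zero).isOpenPosMeasure
  exact IsOpen.measure_pos _ (isOpen_Iio.preimage (by fun_prop)) ⟨0, by simpa using ht⟩

theorem noncentralTail_succ_eq_integral (n : ℕ) (t lam : ℝ) :
    noncentralTail (n + 1) t lam
      = ∫ s, (gaussianReal √lam 1).real {x | t - s < x ^ 2} ∂chiSq n := by
  rw [noncentralTail, noncentralChiSq, real_sumSqLaw_Ioi _ 0]
  simp only [meanVec, Fin.succAbove_zero, Fin.val_succ, Fin.val_zero, if_true,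
    Nat.succ_ne_zero, if_false]
  rfl

/-- The tail probability increases with the noncentrality parameter. -/
theorem strictMonoOn_noncentralTail {q : ℕ} (hq : 1 ≤ q) {t : ℝ} (ht : 0 < t) :
    StrictMonoOn (noncentralTail q t) (Ici 0) := by
  obtain ⟨n, rfl⟩ : ∃ n, q = n + 1 := ⟨q - 1, by omega⟩
  intro a ha b hb hab
  have hprob : IsProbabilityMeasure (chiSq n) := isProbabilityMeasure_sumSqLaw _
  have hsq : √a < √b := Real.sqrt_lt_sqrt ha hab
  rw [noncentralTail_succ_eq_integral, noncentralTail_succ_eq_integral, ← sub_pos,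
    ← integral_sub (integrable_gaussianReal_sq_tail _ _ _)
      (integrable_gaussianReal_sq_tail _ _ _), integral_pos_iff_support_of_nonneg]
  · refine (sumSqLaw_Iio_pos ht).trans_le (measure_mono fun s hs => ?_)
    exact (sub_pos.2 (strictMonoOn_gaussianReal_sq_tail (sub_pos.2 hs) (Real.sqrt_nonneg a)
      (Real.sqrt_nonneg b) hsq)).ne'
  · exact fun s => sub_nonneg.2 (monotoneOn_gaussianReal_sq_tail _ (Real.sqrt_nonneg a)
      (Real.sqrt_nonneg b) hsq.le)
  · exact (integrable_gaussianReal_sq_tail _ _ _).sub (integrable_gaussianReal_sq_tail _ _ _)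

/-! ### Averaging over the sphere by rotation invariance -/

section Sphere

open scoped RealInnerProductSpace

theorem abs_mul_inner_div_norm_le {E : Type*} [NormedAddCommGroup E] [InnerProductSpace ℝ E]
    {u : E} (hu : ‖u‖ = 1) (k : ℝ) (z : E) :
    |k * ⟪u, z⟫ / ‖z‖| ≤ |k| := by
  rw [abs_div, abs_mul, abs_norm]
  refine div_le_of_le_mul₀ (norm_nonneg z) (abs_nonneg k)
    (mul_le_mul_of_nonneg_left ?_ (abs_nonneg k))
  simpa [hu] using abs_real_inner_le_norm u z

variable {E : Type*} [NormedAddCommGroup E] [InnerProductSpace ℝ E] [FiniteDimensional ℝ E]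
  [MeasurableSpace E] [BorelSpace E]

/-- The reflection in the hyperplane orthogonal to `v - v'` exchanges `v` and `v'` and preserves
both the norm and the Gaussian law. -/
theorem lintegral_stdGaussian_norm_inner_congr (f : ℝ → ℝ → ENNReal) {v v' : E}
    (h : ‖v‖ = ‖v'‖) :
    ∫⁻ z, f ‖z‖ ⟪v, z⟫ ∂stdGaussian E = ∫⁻ z, f ‖z‖ ⟪v', z⟫ ∂stdGaussian E := by
  have hr := Submodule.reflection_sub h
  set R := (Submodule.span ℝ {v - v'})ᗮ.reflection
  have hmp : MeasurePreserving R (stdGaussian E) (stdGaussian E) :=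
    ⟨R.continuous.measurable, stdGaussian_map R⟩
  rw [← hmp.lintegral_comp_emb R.toHomeomorph.measurableEmbedding]
  refine lintegral_congr fun z => ?_
  rw [R.norm_map, ← R.inner_map_map v, hr, Submodule.reflection_reflection]

/-- The mean of `cosh (k ⟪u, s⟫)` over the unit sphere, the uniform distribution on which is
realised as the law of `z / ‖z‖` for a standard Gaussian vector `z`. -/
noncomputable def sphereCosh (u : E) (k : ℝ) : ℝ :=
  ∫ z, Real.cosh (k * ⟪u, z⟫ / ‖z‖) ∂stdGaussian E

theorem integrable_cosh_inner_div_norm {u : E} (hu : ‖u‖ = 1) (k : ℝ) :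
    Integrable (fun z : E => Real.cosh (k * ⟪u, z⟫ / ‖z‖)) (stdGaussian E) := by
  refine .of_bound (Measurable.aestronglyMeasurable (Real.measurable_cosh.comp
    (by fun_prop))) (Real.cosh k) (.of_forall fun z => ?_)
  rw [Real.norm_of_nonneg (Real.cosh_pos _).le]
  exact Real.cosh_le_cosh.2 (abs_mul_inner_div_norm_le hu k z)

instance isOpenPosMeasure_stdGaussian {ι : Type*} [Fintype ι] :
    (stdGaussian (EuclideanSpace ℝ ι)).IsOpenPosMeasure := by
  have : (gaussianReal 0 1).IsOpenPosMeasure :=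
    (gaussianReal_absolutelyContinuous' 0 one_ne_zero).isOpenPosMeasure
  rw [← map_pi_eq_stdGaussian]
  exact Continuous.isOpenPosMeasure_map (PiLp.continuous_toLp 2 _) (WithLp.toLp_surjective 2)

theorem monotoneOn_sphereCosh {u : E} (hu : ‖u‖ = 1) :
    MonotoneOn (sphereCosh u) (Ici 0) := by
  intro a ha b _ hab
  refine integral_mono (integrable_cosh_inner_div_norm hu a) (integrable_cosh_inner_div_norm hu b)
    fun z => Real.cosh_le_cosh.2 ?_
  simp only [abs_div, abs_mul]
  gcongr

theorem strictMonoOn_sphereCosh {u : E} [(stdGaussian E).IsOpenPosMeasure] (hu : ‖u‖ = 1) :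
    StrictMonoOn (sphereCosh u) (Ici 0) := by
  intro a ha b hb hab
  have hia := integrable_cosh_inner_div_norm hu a
  have hib := integrable_cosh_inner_div_norm hu b
  rw [sphereCosh, sphereCosh, ← sub_pos, ← integral_sub hib hia,
    integral_pos_iff_support_of_nonneg (f := fun z => Real.cosh (b * ⟪u, z⟫ / ‖z‖)
      - Real.cosh (a * ⟪u, z⟫ / ‖z‖)) _ (hib.sub hia)]
  · refine (IsOpen.measure_pos (stdGaussian E) (U := {z : E | ⟪u, z⟫ ≠ 0})
      (isOpen_ne_fun (by fun_prop) (by fun_prop))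
      ⟨u, by simp [hu]⟩).trans_le (measure_mono fun z hz => ?_)
    have hz' : ⟪u, z⟫ ≠ 0 := hz
    have hz0 : z ≠ 0 := fun h => hz' (by simp [h])
    refine (sub_pos.2 (Real.cosh_lt_cosh.2 ?_)).ne'
    have hab' : |a| < |b| := by rwa [abs_of_nonneg ha, abs_of_nonneg hb]
    simp only [abs_div, abs_mul]
    have := abs_pos.2 hz'
    have := abs_pos.2 (norm_ne_zero_iff.2 hz0)
    gcongr
  · intro z
    refine sub_nonneg.2 (Real.cosh_le_cosh.2 ?_)
    have hab' : |a| ≤ |b| := by rw [abs_of_nonneg ha, abs_of_nonneg hb]; exact hab.le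
    simp only [abs_div, abs_mul]
    gcongr

theorem lintegral_exp_inner_eq_lintegral_cosh {h : ℝ → ENNReal} (hh : Measurable h) (u : E)
    (k : ℝ) :
    ∫⁻ z, ENNReal.ofReal (Real.exp (k * ⟪u, z⟫)) * h ‖z‖ ∂stdGaussian E
      = ∫⁻ z, ENNReal.ofReal (Real.cosh (k * ⟪u, z⟫)) * h ‖z‖ ∂stdGaussian E := by
  have hneg := lintegral_stdGaussian_norm_inner_congr (E := E)
    (fun r x => ENNReal.ofReal (Real.exp (k * x)) * h r) (norm_neg u)
  have hcosh : ∀ z : E, ENNReal.ofReal (Real.cosh (k * ⟪u, z⟫)) * h ‖z‖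
      = 2⁻¹ * (ENNReal.ofReal (Real.exp (k * ⟪u, z⟫)) * h ‖z‖
        + ENNReal.ofReal (Real.exp (k * ⟪-u, z⟫)) * h ‖z‖) := fun z => by
    rw [Real.cosh_eq, ENNReal.ofReal_div_of_pos two_pos, ENNReal.ofReal_add (Real.exp_pos _).le
      (Real.exp_pos _).le, inner_neg_left, mul_neg, ← add_mul, ENNReal.div_eq_inv_mul, mul_assoc]
    simp
  simp_rw [hcosh]
  rw [lintegral_const_mul _ (by fun_prop), lintegral_add_left (by fun_prop), hneg, ← two_mul,
    ← mul_assoc, ENNReal.inv_mul_cancel (by simp) (by simp), one_mul]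

/-- The integral does not depend on the unit vector `u`, so `u` may be replaced by the direction of
an independent Gaussian vector `w`. After Fubini the inner integral averages over that direction
with `z` fixed. This avoids polar coordinates. -/
theorem lintegral_exp_inner_eq_lintegral_sphereCosh [NullSingletonClass (stdGaussian E)]
    {h : ℝ → ENNReal} (hh : Measurable h) {u : E} (hu : ‖u‖ = 1) (k : ℝ) :
    ∫⁻ z, ENNReal.ofReal (Real.exp (k * ⟪u, z⟫)) * h ‖z‖ ∂stdGaussian E
      = ∫⁻ z, ENNReal.ofReal (sphereCosh u (k * ‖z‖)) * h ‖z‖ ∂stdGaussian E := by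
  have hmc := Real.measurable_cosh
  calc ∫⁻ z, ENNReal.ofReal (Real.exp (k * ⟪u, z⟫)) * h ‖z‖ ∂stdGaussian E
      = ∫⁻ z, ENNReal.ofReal (Real.cosh (k * ⟪u, z⟫)) * h ‖z‖ ∂stdGaussian E :=
        lintegral_exp_inner_eq_lintegral_cosh hh u k
    _ = ∫⁻ _ : E, ∫⁻ z, ENNReal.ofReal (Real.cosh (k * ⟪u, z⟫)) * h ‖z‖ ∂stdGaussian E
          ∂stdGaussian E := by simp
    _ = ∫⁻ w : E, ∫⁻ z, ENNReal.ofReal (Real.cosh (k * (⟪w, z⟫ / ‖w‖))) * h ‖z‖ ∂stdGaussian E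
          ∂stdGaussian E := by
        refine lintegral_congr_ae ?_
        filter_upwards [measure_eq_zero_iff_ae_notMem.1 (measure_singleton (0 : E))] with w hw
        have hw0 : ‖w‖ ≠ 0 := norm_ne_zero_iff.2 hw
        have := lintegral_stdGaussian_norm_inner_congr (E := E)
          (fun r x => ENNReal.ofReal (Real.cosh (k * x)) * h r) (v := u) (v' := ‖w‖⁻¹ • w)
          (by rw [hu, norm_smul, norm_inv, norm_norm, inv_mul_cancel₀ hw0])
        simpa [real_inner_smul_left, div_eq_inv_mul] using this
    _ = ∫⁻ z : E, ∫⁻ w, ENNReal.ofReal (Real.cosh (k * (⟪w, z⟫ / ‖w‖))) * h ‖z‖ ∂stdGaussian E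
          ∂stdGaussian E := by
        refine lintegral_lintegral_swap (Measurable.aemeasurable ?_)
        simp only [Function.uncurry_def]
        fun_prop
    _ = ∫⁻ z, ENNReal.ofReal (sphereCosh u (k * ‖z‖)) * h ‖z‖ ∂stdGaussian E := by
        refine lintegral_congr fun z => ?_
        rw [lintegral_mul_const _ (by fun_prop)]
        congr 1
        rw [sphereCosh, ofReal_integral_eq_lintegral_ofReal (integrable_cosh_inner_div_norm hu _)
          (.of_forall fun w => (Real.cosh_pos _).le)]
        -- The roles are now exchanged: `w` is the Gaussian variable, and the fixed vector `z` is
        -- rotated to `‖z‖ • u`.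
        have := lintegral_stdGaussian_norm_inner_congr (E := E)
          (fun r x => ENNReal.ofReal (Real.cosh (k * (x / r)))) (v := z) (v' := ‖z‖ • u)
          (by rw [norm_smul, norm_norm, hu, mul_one])
        simp_rw [real_inner_comm _ z] at this ⊢
        rw [this]
        refine lintegral_congr fun w => ?_
        rw [real_inner_smul_left]
        ring_nf

end Sphere

/-! ### The likelihood ratio of the noncentral law -/

theorem gaussianReal_eq_withDensity_exp (μ : ℝ) :
    gaussianReal μ 1 = (gaussianReal 0 1).withDensity
      fun x => ENNReal.ofReal (Real.exp (μ * x - μ ^ 2 / 2)) := by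
  rw [gaussianReal_of_var_ne_zero _ one_ne_zero, gaussianReal_of_var_ne_zero _ one_ne_zero,
    ← withDensity_mul _ (measurable_gaussianPDF _ _) (by fun_prop)]
  congr 1
  ext x
  rw [Pi.mul_apply, gaussianPDF, gaussianPDF, ← ENNReal.ofReal_mul (gaussianPDFReal_nonneg _ _ _),
    gaussianPDFReal, gaussianPDFReal, mul_assoc _ (Real.exp _), ← Real.exp_add]
  congr 3
  simp only [NNReal.coe_one]
  ring

theorem lintegral_pi_gaussianReal_meanVec {n : ℕ} {lam : ℝ} (hlam : 0 ≤ lam)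
    {F : (Fin (n + 1) → ℝ) → ENNReal} (hF : Measurable F) :
    ∫⁻ x, F x ∂(Measure.pi fun i => gaussianReal (meanVec (n + 1) lam i) 1)
      = ∫⁻ x, ENNReal.ofReal (Real.exp (√lam * x 0 - lam / 2)) * F x
        ∂(Measure.pi fun _ => gaussianReal 0 1) := by
  have h1 := (measurePreserving_piFinSuccAbove
    (fun i => gaussianReal (meanVec (n + 1) lam i) 1) 0).symm
  have h0 := (measurePreserving_piFinSuccAbove
    (fun _ : Fin (n + 1) => gaussianReal 0 1) 0).symm
  have hFe : Measurable fun z : ℝ × (Fin n → ℝ) =>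
      F ((MeasurableEquiv.piFinSuccAbove (fun _ : Fin (n + 1) => ℝ) 0).symm z) :=
    hF.comp (MeasurableEquiv.measurable _)
  rw [← h1.lintegral_comp hF, ← h0.lintegral_comp (by fun_prop), lintegral_prod_symm _
    hFe.aemeasurable, lintegral_prod_symm _ (Measurable.aemeasurable ?_)]
  · have hmv : (fun j : Fin n => gaussianReal (meanVec (n + 1) lam ((0 : Fin (n + 1)).succAbove j)) 1)
        = fun _ => gaussianReal 0 1 := by
      ext1 j; simp [meanVec]
    rw [hmv]
    refine lintegral_congr fun y => ?_
    have hFy : Measurable fun x : ℝ =>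
        F ((MeasurableEquiv.piFinSuccAbove (fun _ : Fin (n + 1) => ℝ) 0).symm (x, y)) :=
      hFe.comp (by fun_prop : Measurable fun x : ℝ => (x, y))
    rw [show meanVec (n + 1) lam 0 = √lam by simp [meanVec], gaussianReal_eq_withDensity_exp √lam,
      lintegral_withDensity_eq_lintegral_mul _ (by fun_prop) hFy]
    refine lintegral_congr fun x => ?_
    simp [Real.sq_sqrt hlam, MeasurableEquiv.piFinSuccAbove]
  · exact (Measurable.mul (f := fun x : Fin (n + 1) → ℝ =>
      ENNReal.ofReal (Real.exp (√lam * x 0 - lam / 2))) (by fun_prop) hF).comp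
        (MeasurableEquiv.measurable _)

/-- The density of the noncentral chi-square distribution with respect to the central one. -/
noncomputable def chiSqDensity (n : ℕ) (lam s : ℝ) : ℝ :=
  Real.exp (-(lam / 2)) *
    sphereCosh (EuclideanSpace.single (0 : Fin (n + 1)) (1 : ℝ)) (√lam * √s)

theorem chiSqDensity_nonneg (n : ℕ) (lam s : ℝ) : 0 ≤ chiSqDensity n lam s :=
  mul_nonneg (Real.exp_pos _).le (integral_nonneg fun _ => (Real.cosh_pos _).le)

/-- `cosh` is even and increasing in the absolute value, hence so is its spherical mean. Since `√s =
0` for `s < 0`, monotonicity holds on the whole line, but strictness only on `Ici 0`. -/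
theorem monotone_chiSqDensity (n : ℕ) (lam : ℝ) : Monotone (chiSqDensity n lam) := by
  intro s t hst
  refine mul_le_mul_of_nonneg_left (monotoneOn_sphereCosh (by simp) ?_ ?_ ?_) (Real.exp_pos _).le
  · exact mem_Ici.2 (by positivity)
  · exact mem_Ici.2 (by positivity)
  · gcongr

theorem strictMonoOn_chiSqDensity (n : ℕ) {lam : ℝ} (hlam : 0 < lam) :
    StrictMonoOn (chiSqDensity n lam) (Ici 0) := by
  intro s hs t ht hst
  refine mul_lt_mul_of_pos_left (strictMonoOn_sphereCosh (by simp) ?_ ?_ ?_) (Real.exp_pos _)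
  · exact mem_Ici.2 (by positivity)
  · exact mem_Ici.2 (by positivity)
  · exact mul_lt_mul_of_pos_left (Real.sqrt_lt_sqrt hs hst) (Real.sqrt_pos.2 hlam)

instance nullSingletonClass_stdGaussian (n : ℕ) :
    NullSingletonClass (stdGaussian (EuclideanSpace ℝ (Fin (n + 1)))) := by
  refine ⟨fun z => ?_⟩
  have : NullSingletonClass (gaussianReal 0 1) := nullSingletonClass_gaussianReal one_ne_zero
  rw [← map_pi_eq_stdGaussian, Measure.map_apply (by fun_prop) (measurableSet_singleton z)]
  refine (Set.Subsingleton.measure_zero ?_ _)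
  exact fun x hx y hy => WithLp.toLp_injective 2 (hx.trans hy.symm)

/-- The Gaussian likelihood ratio `exp (√lam * x 0 - lam / 2)`, averaged over the sphere of radius
`√s`, is the density at `s`. -/
theorem noncentralChiSq_eq_withDensity (n : ℕ) {lam : ℝ} (hlam : 0 ≤ lam) :
    noncentralChiSq (n + 1) lam
      = (chiSq (n + 1)).withDensity fun s => ENNReal.ofReal (chiSqDensity n lam s) := by
  have hdm : Measurable (chiSqDensity n lam) := (monotone_chiSqDensity n lam).measurable
  have hchi : chiSq (n + 1)
      = (stdGaussian (EuclideanSpace ℝ (Fin (n + 1)))).map fun z => ‖z‖ ^ 2 := by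
    rw [chiSq, sumSqLaw_eq_map_stdGaussian]
    simp
  refine Measure.ext_of_lintegral _ fun h hh => ?_
  set u : EuclideanSpace ℝ (Fin (n + 1)) := EuclideanSpace.single 0 1
  rw [lintegral_withDensity_eq_lintegral_mul _ (by fun_prop) hh, hchi,
    lintegral_map (by fun_prop) (by fun_prop), noncentralChiSq, sumSqLaw,
    lintegral_map hh (by fun_prop), lintegral_pi_gaussianReal_meanVec hlam (by fun_prop)]
  have hpi : ∫⁻ x : Fin (n + 1) → ℝ, ENNReal.ofReal (Real.exp (√lam * x 0 - lam / 2))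
        * h (∑ i, x i ^ 2) ∂(Measure.pi fun _ => gaussianReal 0 1)
      = ∫⁻ z, ENNReal.ofReal (Real.exp (√lam * inner ℝ u z)) *
        (ENNReal.ofReal (Real.exp (-(lam / 2))) * h (‖z‖ ^ 2)) ∂stdGaussian _ := by
    rw [← map_pi_eq_stdGaussian, lintegral_map (by fun_prop) (by fun_prop)]
    refine lintegral_congr fun x => ?_
    rw [← mul_assoc, ← ENNReal.ofReal_mul (Real.exp_pos _).le, ← Real.exp_add,
      EuclideanSpace.norm_sq_eq]
    simp [u, sub_eq_add_neg, EuclideanSpace.inner_single_left]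
  rw [hpi, lintegral_exp_inner_eq_lintegral_sphereCosh
    (h := fun r => ENNReal.ofReal (Real.exp (-(lam / 2))) * h (r ^ 2)) (by fun_prop)
    (by simp [u]) √lam]
  refine lintegral_congr fun z => ?_
  rw [Pi.mul_apply, chiSqDensity, ENNReal.ofReal_mul (Real.exp_pos _).le,
    Real.sqrt_sq (norm_nonneg z)]
  ring

/-- The Neyman–Pearson lemma on the line: for a monotone likelihood ratio, the upper half-line is
strictly more powerful than a randomised test of the same size that accepts the alternative
with positive probability below the threshold. -/
theorem integral_mul_lt_setIntegral_Ioi {μ : Measure ℝ} [IsProbabilityMeasure μ] {l a : ℝ → ℝ}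
    {τ : ℝ} (hl : Monotone l) (hl' : StrictMonoOn l (Ici 0)) (hli : Integrable l μ)
    (ham : Measurable a) (ha0 : ∀ s, 0 < a s) (ha1 : ∀ s, a s ≤ 1)
    (hsize : ∫ s, a s ∂μ = μ.real (Ioi τ)) (hμ : 0 < μ (Ioo 0 τ)) :
    ∫ s, a s * l s ∂μ < ∫ s in Ioi τ, l s ∂μ := by
  have hbd : ∀ s, ‖a s‖ ≤ 1 := fun s => by rw [Real.norm_of_nonneg (ha0 s).le]; exact ha1 s
  have hai : Integrable a μ := .of_bound ham.aestronglyMeasurable 1 (.of_forall hbd)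
  have hali : Integrable (fun s => a s * l s) μ :=
    hli.bdd_mul ham.aestronglyMeasurable (.of_forall hbd)
  have h1i : Integrable ((Ioi τ).indicator (1 : ℝ → ℝ)) μ :=
    (integrable_const (1 : ℝ)).indicator measurableSet_Ioi
  have hlii : Integrable ((Ioi τ).indicator l) μ := hli.indicator measurableSet_Ioi
  -- The left side is nonnegative, its factors having the same sign on each side of `τ`; on `Ioo 0
  -- τ` both are negative. The multiple of `l τ` integrates to zero by `hsize`.
  have hexp : ∀ s, ((Ioi τ).indicator 1 s - a s) * (l s - l τ)
      = ((Ioi τ).indicator l s - a s * l s) - l τ * ((Ioi τ).indicator 1 s - a s) := fun s => by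
    by_cases hs : s ∈ Ioi τ <;> simp [hs] <;> ring
  have hdl : Integrable (fun s => (Ioi τ).indicator l s - a s * l s) μ := hlii.sub hali
  have hd1 : Integrable (fun s => l τ * ((Ioi τ).indicator 1 s - a s)) μ :=
    (h1i.sub hai).const_mul _
  have hint : Integrable (fun s => ((Ioi τ).indicator 1 s - a s) * (l s - l τ)) μ := by
    simp_rw [hexp]
    exact hdl.sub hd1
  have hpos : 0 < ∫ s, ((Ioi τ).indicator 1 s - a s) * (l s - l τ) ∂μ := by
    rw [integral_pos_iff_support_of_nonneg _ hint]
    · refine hμ.trans_le (measure_mono fun s hs => ?_)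
      have hs' : s ∉ Ioi τ := not_lt.2 hs.2.le
      have hls : l s < l τ := hl' hs.1.le (hs.1.trans hs.2).le hs.2
      simpa [hs', Function.mem_support, sub_eq_zero] using ⟨(ha0 s).ne', hls.ne⟩
    · intro s
      by_cases hs : s ∈ Ioi τ
      · simpa [hs] using mul_nonneg (sub_nonneg.2 (ha1 s)) (sub_nonneg.2 (hl (le_of_lt hs)))
      · simpa [hs] using mul_nonneg_of_nonpos_of_nonpos (neg_nonpos.2 (ha0 s).le)
          (sub_nonpos.2 (hl (not_lt.1 hs)))
  simp_rw [hexp] at hpos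
  rw [integral_sub hdl hd1, integral_const_mul,
    integral_sub h1i hai, integral_sub hlii hali, integral_indicator_one measurableSet_Ioi,
    integral_indicator measurableSet_Ioi, hsize] at hpos
  linarith

/-! ### Comparison of consecutive degrees of freedom -/

theorem integrable_chiSqDensity (n : ℕ) {lam : ℝ} (hlam : 0 ≤ lam) :
    Integrable (chiSqDensity n lam) (chiSq (n + 1)) := by
  have hprob : IsProbabilityMeasure (noncentralChiSq (n + 1) lam) := isProbabilityMeasure_sumSqLaw _
  refine ⟨(monotone_chiSqDensity n lam).measurable.aestronglyMeasurable, ?_⟩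
  rw [hasFiniteIntegral_iff_ofReal (.of_forall (chiSqDensity_nonneg n lam)),
    ← setLIntegral_univ, ← withDensity_apply _ MeasurableSet.univ,
    ← noncentralChiSq_eq_withDensity n hlam]
  exact measure_lt_top _ _

theorem integral_noncentralChiSq (n : ℕ) {lam : ℝ} (hlam : 0 ≤ lam) (g : ℝ → ℝ) :
    ∫ s, g s ∂noncentralChiSq (n + 1) lam
      = ∫ s, g s * chiSqDensity n lam s ∂chiSq (n + 1) := by
  have hdm : Measurable (chiSqDensity n lam) := (monotone_chiSqDensity n lam).measurable
  rw [noncentralChiSq_eq_withDensity n hlam, integral_withDensity_eq_integral_toReal_smul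
    (by fun_prop) (by simp)]
  simp [ENNReal.toReal_ofReal (chiSqDensity_nonneg n lam _), mul_comm]

theorem noncentralTail_eq_setIntegral (n : ℕ) {lam : ℝ} (hlam : 0 ≤ lam) (t : ℝ) :
    noncentralTail (n + 1) t lam
      = ∫ s in Ioi t, chiSqDensity n lam s ∂chiSq (n + 1) := by
  rw [noncentralTail, ← integral_indicator_one measurableSet_Ioi, integral_noncentralChiSq n hlam,
    ← integral_indicator measurableSet_Ioi]
  refine integral_congr_ae (.of_forall fun s => ?_)
  by_cases hs : s ∈ Ioi t <;> simp [hs]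

/-- Splitting off the last coordinate, of mean zero, leaves an integrand free of `lam`: the critical
function of a randomised test on `s`. -/
theorem noncentralTail_succ_succ_eq_integral (n : ℕ) (t lam : ℝ) :
    noncentralTail (n + 2) t lam
      = ∫ s, (gaussianReal 0 1).real {x | t - s < x ^ 2} ∂noncentralChiSq (n + 1) lam := by
  have h : (fun i => meanVec (n + 2) lam ((Fin.last (n + 1)).succAbove i))
      = meanVec (n + 1) lam := by
    ext i; simp [meanVec]
  have hlast : meanVec (n + 2) lam (Fin.last (n + 1)) = 0 := by simp [meanVec]
  rw [noncentralTail, noncentralChiSq, real_sumSqLaw_Ioi _ (Fin.last (n + 1)), h, hlast,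
    noncentralChiSq]

theorem noncentralTail_zero (q : ℕ) (t : ℝ) : noncentralTail q t 0 = tail q t := by
  rw [noncentralTail, noncentralChiSq_zero, tail]

/-- At equal size, the test with an additional degree of freedom is strictly less powerful. -/
theorem noncentralTail_succ_lt {n : ℕ} {lam t t' : ℝ} (hlam : 0 < lam) (ht : 0 < t)
    (h : tail (n + 2) t' = tail (n + 1) t) :
    noncentralTail (n + 2) t' lam < noncentralTail (n + 1) t lam := by
  have hprob : IsProbabilityMeasure (chiSq (n + 1)) := isProbabilityMeasure_sumSqLaw _
  rw [noncentralTail_eq_setIntegral n hlam.le, noncentralTail_succ_succ_eq_integral,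
    integral_noncentralChiSq n hlam.le]
  refine integral_mul_lt_setIntegral_Ioi (monotone_chiSqDensity n lam)
    (strictMonoOn_chiSqDensity n hlam) (integrable_chiSqDensity n hlam.le)
    (measurable_gaussianReal_sq_tail 0 t') (fun s => gaussianReal_sq_tail_pos _ _)
    (fun s => measureReal_le_one) ?_ (sumSqLaw_Ioo_pos 0 le_rfl ht)
  -- The size of the randomised test is its power at `lam = 0`.
  rw [← noncentralChiSq_zero, ← noncentralTail_succ_succ_eq_integral, noncentralTail_zero, h,
    noncentralChiSq_zero, tail]

/-! ### Threshold and detection probability -/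

theorem noncentralTail_at_zero {q : ℕ} (hq : 1 ≤ q) (lam : ℝ) :
    noncentralTail q 0 lam = 1 := by
  obtain ⟨n, rfl⟩ : ∃ n, q = n + 1 := ⟨q - 1, by omega⟩
  have h : sumSqLaw (meanVec (n + 1) lam) (Iic 0) = 0 := by
    rw [← Iio_union_right]
    exact measure_union_null (sumSqLaw_Iio_zero _) (sumSqLaw_singleton _ 0)
  rw [noncentralTail, noncentralChiSq, ← compl_Iic, probReal_compl_eq_one_sub measurableSet_Iic,
    measureReal_def, h, ENNReal.toReal_zero, sub_zero]

theorem threshold_nonneg {q : ℕ} (hq : 1 ≤ q) {PF : ℝ} (hPF : PF ∈ Ioc (0 : ℝ) 1) :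
    0 ≤ threshold q PF :=
  Function.invFunOn_mem ((bijOn_tail hq).surjOn hPF)

theorem tail_threshold {q : ℕ} (hq : 1 ≤ q) {PF : ℝ} (hPF : PF ∈ Ioc (0 : ℝ) 1) :
    tail q (threshold q PF) = PF :=
  Function.invFunOn_eq ((bijOn_tail hq).surjOn hPF)

theorem threshold_one {q : ℕ} (hq : 1 ≤ q) : threshold q 1 = 0 :=
  (bijOn_tail hq).injOn (threshold_nonneg hq ⟨one_pos, le_rfl⟩) self_mem_Ici
    ((tail_threshold hq ⟨one_pos, le_rfl⟩).trans
      ((noncentralTail_zero q 0).symm.trans (noncentralTail_at_zero hq 0)).symm)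

theorem threshold_pos {q : ℕ} (hq : 1 ≤ q) {PF : ℝ} (hPF : PF ∈ Ioc (0 : ℝ) 1) (h1 : PF < 1) :
    0 < threshold q PF := by
  refine (threshold_nonneg hq hPF).lt_of_ne fun h0 => h1.ne ?_
  rw [← tail_threshold hq hPF, ← h0, ← noncentralTail_zero, noncentralTail_at_zero hq]

theorem detectionProb_one {q : ℕ} (hq : 1 ≤ q) (lam : ℝ) : detectionProb q lam 1 = 1 := by
  rw [detectionProb, threshold_one hq, noncentralTail_at_zero hq]

theorem detectionProb_zero {q : ℕ} (hq : 1 ≤ q) {PF : ℝ} (hPF : PF ∈ Ioc (0 : ℝ) 1) :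
    detectionProb q 0 PF = PF := by
  rw [detectionProb, noncentralTail_zero, tail_threshold hq hPF]

theorem strictMonoOn_detectionProb {q : ℕ} (hq : 1 ≤ q) {PF : ℝ} (hPF : PF ∈ Ioc (0 : ℝ) 1)
    (h1 : PF < 1) : StrictMonoOn (fun lam => detectionProb q lam PF) (Ici 0) :=
  strictMonoOn_noncentralTail hq (threshold_pos hq hPF h1)

theorem strictAntiOn_detectionProb {lam : ℝ} (hlam : 0 < lam) {PF : ℝ}
    (hPF : PF ∈ Ioc (0 : ℝ) 1) (h1 : PF < 1) :
    StrictAntiOn (fun q => detectionProb q lam PF) (Ici 1) := by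
  refine strictAntiOn_of_succ_lt ordConnected_Ici fun q _ hq _ => ?_
  obtain ⟨n, rfl⟩ : ∃ n, q = n + 1 := ⟨q - 1, (Nat.sub_add_cancel hq).symm⟩
  refine noncentralTail_succ_lt hlam (threshold_pos hq hPF h1) ?_
  exact (tail_threshold (q := n + 2) (by omega) hPF).trans (tail_threshold hq hPF).symm

end ChiSquareTest

theorem mainTheorem3 (PF : ℝ) (hPF : PF ∈ Set.Ioc (0 : ℝ) 1) :
    -- increasing in the noncentrality parameter
    (∀ q : ℕ, 1 ≤ q →
      MonotoneOn (fun lam : ℝ => ChiSquareTest.detectionProb q lam PF) (Set.Ici 0)) ∧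
    -- decreasing in the number of degrees of freedom
    (∀ lam : ℝ, 0 ≤ lam →
      AntitoneOn (fun q : ℕ => ChiSquareTest.detectionProb q lam PF) (Set.Ici 1)) ∧
    -- both strictly, outside of the degenerate cases
    (PF < 1 →
      (∀ q : ℕ, 1 ≤ q →
        StrictMonoOn (fun lam : ℝ => ChiSquareTest.detectionProb q lam PF) (Set.Ici 0)) ∧
      (∀ lam : ℝ, 0 < lam →
        StrictAntiOn (fun q : ℕ => ChiSquareTest.detectionProb q lam PF) (Set.Ici 1))) := by
  refine ⟨fun q hq => ?_, fun lam hlam => ?_, fun h1 =>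
    ⟨fun q hq => ChiSquareTest.strictMonoOn_detectionProb hq hPF h1,
      fun lam hlam => ChiSquareTest.strictAntiOn_detectionProb hlam hPF h1⟩⟩
  -- Only the degenerate cases remain beyond the strict statements: the detection probability is
  -- constantly `1` for `PF = 1`, and constantly `PF` in `q` for `lam = 0`.
  · rcases hPF.2.lt_or_eq with h1 | rfl
    · exact (ChiSquareTest.strictMonoOn_detectionProb hq hPF h1).monotoneOn
    · intro a _ b _ _
      simp only [ChiSquareTest.detectionProb_one hq, le_refl]
  · rcases hPF.2.lt_or_eq with h1 | rfl
    · rcases hlam.lt_or_eq with hlam | rfl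
      · exact (ChiSquareTest.strictAntiOn_detectionProb hlam hPF h1).antitoneOn
      · intro a ha b hb _
        simp only [ChiSquareTest.detectionProb_zero ha hPF,
          ChiSquareTest.detectionProb_zero hb hPF, le_refl]
    · intro a ha b hb _
      simp only [ChiSquareTest.detectionProb_one ha, ChiSquareTest.detectionProb_one hb, le_refl]
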